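/- For a positive integer $n$ let $\mathrm{Sym}(n,\mathbb R)$ be the space of real symmetric $n\times n$ matrices, let $N=\frac{n(n+1)}{2}$, let $dA=\prod_{1\le i\le j\le n}dA_{ij}$ be the Lebesgue measure on $\mathrm{Sym}(n,\mathbb R)$ and let $\|A\|=\sqrt{\operatorname{tr}(A^2)}$ be the Frobenius norm. Let $\mathrm{GOE}(n)$ be the probability measure on $\mathrm{Sym}(n,\mathbb R)$ given by $$\mathbb P\{U\}=\frac{1}{\sqrt2^{\,n}\sqrt\pi^{\,N}}\int_U e^{-\|A\|^2/2}\,dA .$$ **Theorem.** For every positive integer $k$, $$\int_{\mathbb R}\ \mathbb E_{Q\sim\mathrm{GOE}(k)}\big[\det(Q-u\mathbb 1)^2\big]\,e^{-u^2}\,du=\sqrt\pi\,\frac{(k+2)!}{2^{k+1}},$$ where $\mathbb 1$ is the $k\times k$ identity matrix; here the expectation is finite for every $u\in\mathbb R$, and the integral converges. -/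

import Mathlib

open MeasureTheory

/-- The space `Sym(n, ℝ)` of real symmetric `n × n` matrices. -/
abbrev SymMat (n : ℕ) : Type := {A : Matrix (Fin n) (Fin n) ℝ // A.IsSymm}

/-- The sigma-algebra on `Sym(n, ℝ)` generated by the matrix entries. -/
instance SymMat.instMeasurableSpace (n : ℕ) : MeasurableSpace (SymMat n) :=
  MeasurableSpace.comap (fun A (p : Fin n × Fin n) => A.1 p.1 p.2) inferInstance

/-- The index set of the coordinates `A i j` with `i ≤ j` on `Sym(n, ℝ)`. -/
abbrev UpperIdx (n : ℕ) : Type := {p : Fin n × Fin n // p.1 ≤ p.2}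

/-- The symmetric matrix whose entries on and above the diagonal are the given numbers. -/
def SymMat.ofUpper {n : ℕ} (x : UpperIdx n → ℝ) : SymMat n :=
  ⟨Matrix.of fun i j => x ⟨(min i j, max i j), min_le_max⟩, by
    ext i j
    simp [Matrix.transpose_apply, min_comm, max_comm]⟩

/-- Filling in the upper entries is measurable, so its push-forward below is the genuine one. -/
theorem SymMat.measurable_ofUpper (n : ℕ) :
    Measurable (SymMat.ofUpper : (UpperIdx n → ℝ) → SymMat n) := by
  refine Measurable.of_comap_le ?_
  rw [SymMat.instMeasurableSpace, MeasurableSpace.comap_comp]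
  refine Measurable.comap_le (measurable_pi_lambda _ fun p => ?_)
  exact measurable_pi_apply (⟨(min p.1 p.2, max p.1 p.2), min_le_max⟩ : UpperIdx n)

/-- The Frobenius norm `‖A‖ = √(tr (A²))` of a symmetric matrix. -/
noncomputable def SymMat.frobenius {n : ℕ} (A : SymMat n) : ℝ :=
  √((A.1 * A.1).trace)

/-- The Lebesgue measure `dA = ∏_{i ≤ j} dA_{ij}` on `Sym(n, ℝ)`. -/
noncomputable def SymMat.lebesgue (n : ℕ) : Measure (SymMat n) :=
  (volume : Measure (UpperIdx n → ℝ)).map SymMat.ofUpper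

/-- The Gaussian Orthogonal Ensemble: the measure on `Sym(n, ℝ)` with density
`exp (-‖A‖² / 2) / (√2 ^ n * √π ^ N)`, `N = n (n + 1) / 2`, with respect to `dA`. -/
noncomputable def GOE (n : ℕ) : Measure (SymMat n) :=
  (SymMat.lebesgue n).withDensity fun A =>
    ENNReal.ofReal
      (1 / (√2 ^ n * √Real.pi ^ (n * (n + 1) / 2)) * Real.exp (-(A.frobenius ^ 2) / 2))

open ProbabilityTheory ENNReal NNReal

theorem Matrix.derivative_det_eq_sum {n R : Type*} [Fintype n] [DecidableEq n] [CommRing R]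
    (M : Matrix n n (Polynomial R)) :
    Polynomial.derivative M.det =
      ∑ i, (M.updateRow i fun j => Polynomial.derivative (M i j)).det := by
  have hdet : ∀ N : Matrix n n (Polynomial R),
      N.det = ∑ σ : Equiv.Perm n, (Equiv.Perm.sign σ : Polynomial R) * ∏ i, N i (σ i) := fun N => by
    rw [← Matrix.det_transpose, Matrix.det_apply']; rfl
  simp_rw [hdet, Polynomial.derivative_sum]
  rw [Finset.sum_comm]
  refine Finset.sum_congr rfl fun σ _ => ?_
  rw [Polynomial.derivative_intCast_mul, Polynomial.derivative_prod_finset, Finset.mul_sum]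
  refine Finset.sum_congr rfl fun i _ => ?_
  congr 1
  rw [← Finset.prod_erase_mul Finset.univ _ (Finset.mem_univ i)]
  congr 1
  · refine Finset.prod_congr rfl fun j hj => ?_
    simp [Matrix.updateRow_ne (Finset.ne_of_mem_erase hj)]
  · simp

theorem Matrix.derivative_charpoly_eq_trace {n R : Type*} [Fintype n] [DecidableEq n] [CommRing R]
    (M : Matrix n n R) :
    Polynomial.derivative M.charpoly = M.charmatrix.adjugate.trace := by
  rw [Matrix.charpoly, Matrix.derivative_det_eq_sum, Matrix.trace]
  refine Finset.sum_congr rfl fun i _ => ?_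
  rw [Matrix.diag_apply, Matrix.adjugate_apply]
  congr 2
  ext1 j
  by_cases h : i = j
  · subst h; simp
  · simp [Matrix.charmatrix_apply_ne _ _ _ h, Pi.single_eq_of_ne (Ne.symm h)]

theorem Matrix.adjugate_charmatrix_map_eval {n R : Type*} [Fintype n] [DecidableEq n] [CommRing R]
    (M : Matrix n n R) (a : R) :
    M.charmatrix.adjugate.map (Polynomial.eval a) = (Matrix.scalar n a - M).adjugate := by
  have h := RingHom.map_adjugate (Polynomial.evalRingHom a) M.charmatrix
  rw [RingHom.mapMatrix_apply, RingHom.mapMatrix_apply, Polynomial.coe_evalRingHom] at h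
  rw [h]
  congr 1
  ext i j
  by_cases hij : i = j
  · subst hij; simp
  · simp [hij]

theorem Matrix.trace_adjugate_scalar_sub {n R : Type*} [Fintype n] [DecidableEq n] [CommRing R]
    (M : Matrix n n R) (a : R) :
    (Matrix.scalar n a - M).adjugate.trace = M.charpoly.derivative.eval a := by
  rw [Matrix.derivative_charpoly_eq_trace, ← Matrix.adjugate_charmatrix_map_eval, Matrix.trace,
    Matrix.trace, Polynomial.eval_finsetSum]
  rfl

theorem Matrix.sub_mul_trace_adjugate_mul_adjugate {n R : Type*} [Fintype n] [DecidableEq n]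
    [CommRing R] (M : Matrix n n R) (a b : R) :
    (a - b) * ((Matrix.scalar n a - M).adjugate * (Matrix.scalar n b - M).adjugate).trace =
      M.charpoly.eval a * M.charpoly.derivative.eval b -
        M.charpoly.derivative.eval a * M.charpoly.eval b := by
  rw [← Matrix.trace_adjugate_scalar_sub, ← Matrix.trace_adjugate_scalar_sub,
    Matrix.eval_charpoly, Matrix.eval_charpoly]
  set A := Matrix.scalar n a - M with hA
  set B := Matrix.scalar n b - M with hB
  have hAB : A - B = (a - b) • (1 : Matrix n n R) := by
    rw [hA, hB, sub_sub_sub_cancel_right, ← map_sub, Matrix.smul_one_eq_diagonal]; rfl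
  have key : (a - b) • (A.adjugate * B.adjugate) = A.det • B.adjugate - B.det • A.adjugate := by
    calc (a - b) • (A.adjugate * B.adjugate)
        = A.adjugate * (A - B) * B.adjugate := by rw [hAB]; simp
      _ = A.det • B.adjugate - B.det • A.adjugate := by
        rw [mul_sub, sub_mul, Matrix.adjugate_mul, mul_assoc, Matrix.mul_adjugate]; simp
  have := congrArg Matrix.trace key
  rw [Matrix.trace_smul, Matrix.trace_sub, Matrix.trace_smul, Matrix.trace_smul] at this
  simp only [smul_eq_mul] at this
  rw [this]; ring

/-- Expansion of a determinant along its first row and first column. -/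
theorem Matrix.det_eq_mul_det_sub_sum_adjugate {R : Type*} [CommRing R] [IsDomain R] {k : ℕ}
    (N : Matrix (Fin (k + 1)) (Fin (k + 1)) R) (hN : (N.submatrix Fin.succ Fin.succ).det ≠ 0) :
    N.det = N 0 0 * (N.submatrix Fin.succ Fin.succ).det -
      ∑ i, ∑ j, N 0 i.succ * (N.submatrix Fin.succ Fin.succ).adjugate i j * N j.succ 0 := by
  set A := N.submatrix Fin.succ Fin.succ with hA
  let v : Fin k → R := fun i => ∑ j, A.adjugate i j * N j.succ 0
  let P : Matrix (Fin (k + 1)) (Fin (k + 1)) R :=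
    Matrix.of (Fin.cons (Fin.cons A.det 0) fun i => Fin.cons (-v i) ((1 : Matrix _ _ R) i))
  have hP : P.det = A.det := by
    have hs : P.submatrix Fin.succ Fin.succ = 1 := by ext i j; simp [P]
    rw [Matrix.det_succ_row_zero, Fin.sum_univ_succ]
    simp [P] 
    rw [← hs.symm.trans rfl]; simp
  have hv : ∀ i, ∑ j, A i j * v j = A.det * N i.succ 0 := fun i => by
    have h := congrFun (congrArg (fun B => B.mulVec fun j => N j.succ 0) (Matrix.mul_adjugate A)) i
    simp only [← Matrix.mulVec_mulVec, Matrix.smul_mulVec, Matrix.one_mulVec] at h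
    simpa [Matrix.mulVec, dotProduct] using h
  have hNP0 : ∀ i : Fin k, (N * P) i.succ 0 = 0 := fun i => by
    rw [Matrix.mul_apply, Fin.sum_univ_succ]
    have := hv i
    simp only [hA, Matrix.submatrix_apply] at this
    simp [P, this, mul_comm, hA]
  have hNP00 : (N * P) 0 0 = N 0 0 * A.det - ∑ i, N 0 i.succ * v i := by
    rw [Matrix.mul_apply, Fin.sum_univ_succ]
    simp [P, sub_eq_add_neg]
  have hNPs : (N * P).submatrix Fin.succ Fin.succ = A := by
    ext i j
    rw [Matrix.submatrix_apply, Matrix.mul_apply, Fin.sum_univ_succ]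
    simp [P, hA, Matrix.one_apply]
  have hdet : (N * P).det = (N * P) 0 0 * A.det := by
    rw [Matrix.det_succ_column_zero, Fin.sum_univ_succ]
    simp [hNP0, ← hNPs]
  rw [Matrix.det_mul, hP] at hdet
  rw [mul_right_cancel₀ hN hdet, hNP00]
  simp only [v, Finset.mul_sum, mul_assoc]

theorem Matrix.eval_charpoly_succ {k : ℕ} (N : Matrix (Fin (k + 1)) (Fin (k + 1)) ℝ) (a : ℝ) :
    N.charpoly.eval a = (a - N 0 0) * (N.submatrix Fin.succ Fin.succ).charpoly.eval a -
      ∑ i, ∑ j, N 0 i.succ *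
        (Matrix.scalar (Fin k) a - N.submatrix Fin.succ Fin.succ).adjugate i j * N j.succ 0 := by
  have hs : N.charmatrix.submatrix Fin.succ Fin.succ =
      (N.submatrix Fin.succ Fin.succ).charmatrix := by
    ext1 i j
    by_cases h : i = j
    · subst h; simp
    · simp [Matrix.charmatrix_apply_ne, h]
  have hne : (N.charmatrix.submatrix Fin.succ Fin.succ).det ≠ 0 := by
    rw [hs]; exact (Matrix.charpoly_monic _).ne_zero
  rw [Matrix.charpoly, Matrix.det_eq_mul_det_sub_sum_adjugate _ hne, hs,
    ← Matrix.adjugate_charmatrix_map_eval]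
  simp [Polynomial.eval_finsetSum, Matrix.charmatrix_apply_ne, Fin.succ_ne_zero,
    (Fin.succ_ne_zero _).symm, Matrix.charpoly]

open Polynomial in
/-- Up to normalisation, the Laguerre polynomial of degree `k` and parameter `2` at `-2 X`. -/
noncomputable def detCorrelation : ℕ → ℝ[X]
  | 0 => 1
  | k + 1 => (X + C (3 / 2)) * detCorrelation k + (X + C (3 / 4)) * derivative (detCorrelation k) +
      C (1 / 4) * X * derivative (derivative (detCorrelation k))

open Polynomial in
theorem detCorrelation_ode (k : ℕ) :
    X * derivative (detCorrelation k) + C (1 / 2) * (X * derivative (derivative (detCorrelation k)) +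
      C 3 * derivative (detCorrelation k)) = C (k : ℝ) * detCorrelation k := by
  induction k with
  | zero => simp [detCorrelation]
  | succ k ih =>
    have h1 := congrArg derivative ih
    have h2 := congrArg derivative h1
    rw [detCorrelation]
    generalize detCorrelation k = f at *
    have e1 : (C (3 / 2) : ℝ[X]) = 6 * C (1 / 4) := by
      rw [show (6 : ℝ[X]) = C 6 from rfl, ← C_mul]; norm_num
    have e2 : (C (3 / 4) : ℝ[X]) = 3 * C (1 / 4) := by
      rw [show (3 : ℝ[X]) = C 3 from rfl, ← C_mul]; norm_num
    have e3 : (C (1 / 2) : ℝ[X]) = 2 * C (1 / 4) := by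
      rw [show (2 : ℝ[X]) = C 2 from rfl, ← C_mul]; norm_num
    have e4 : 4 * C (1 / 4) = (1 : ℝ[X]) := by
      rw [show (4 : ℝ[X]) = C 4 from rfl, ← C_mul]; norm_num
    have e5 : (C 3 : ℝ[X]) = 3 := rfl
    simp only [e1, e2, e3, e5, derivative_add, derivative_mul, derivative_X, derivative_C,
      derivative_ofNat, derivative_one, derivative_zero, Nat.cast_add, Nat.cast_one, C_add, C_1] at *
    generalize (C (1 / 4) : ℝ[X]) = c at *
    linear_combination (X + 6 * c) * ih + (X + 3 * c) * h1 + c * X * h2 + X * derivative f * e4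

theorem detCorrelation_eval_zero (k : ℕ) :
    (detCorrelation k).eval 0 = ((k + 2).factorial : ℝ) / 2 ^ (k + 1) := by
  induction k with
  | zero => simp [detCorrelation]
  | succ k ih =>
    have h := congrArg (Polynomial.eval 0) (detCorrelation_ode k)
    simp only [Polynomial.eval_add, Polynomial.eval_mul, Polynomial.eval_X, Polynomial.eval_C] at h
    rw [show k + 1 + 2 = (k + 2) + 1 from rfl, Nat.factorial_succ, detCorrelation]
    simp only [Polynomial.eval_add, Polynomial.eval_mul, Polynomial.eval_X, Polynomial.eval_C]
    push_cast
    rw [show (3 / 4 : ℝ) = 1 / 2 * (3 / 2) by norm_num]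
    have : ((k + 2).factorial : ℝ) = Polynomial.eval 0 (detCorrelation k) * 2 ^ (k + 1) := by
      rw [ih]; field_simp
    rw [this]
    field_simp
    rw [pow_succ]
    linear_combination 32 * 2 ^ k * h

theorem pi_gaussianReal_eq_withDensity {ι : Type*} [Fintype ι] (m : ι → ℝ) (v : ι → ℝ≥0)
    (hv : ∀ i, v i ≠ 0) :
    Measure.pi (fun i => gaussianReal (m i) (v i)) =
      (volume : Measure (ι → ℝ)).withDensity fun x =>
        ENNReal.ofReal (∏ i, gaussianPDFReal (m i) (v i) (x i)) := by
  refine Measure.pi_eq fun s hs => ?_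
  have hint : ∀ i, Integrable ((s i).indicator (gaussianPDFReal (m i) (v i))) volume := fun i =>
    (integrable_gaussianPDFReal _ _).indicator (hs i)
  have hnn : ∀ i x, 0 ≤ (s i).indicator (gaussianPDFReal (m i) (v i)) x := fun i x =>
    Set.indicator_nonneg (fun y _ => gaussianPDFReal_nonneg _ _ y) x
  have hind : ∀ x : ι → ℝ, (Set.univ.pi s).indicator
      (fun x => ENNReal.ofReal (∏ i, gaussianPDFReal (m i) (v i) (x i))) x =
        ENNReal.ofReal (∏ i, (s i).indicator (gaussianPDFReal (m i) (v i)) (x i)) := fun x => by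
    by_cases hx : x ∈ Set.univ.pi s
    · rw [Set.indicator_of_mem hx]
      congr 1
      exact Finset.prod_congr rfl fun i _ => (Set.indicator_of_mem (hx i trivial) _).symm
    · rw [Set.indicator_of_notMem hx]
      simp only [Set.mem_univ_pi, not_forall] at hx
      obtain ⟨i, hi⟩ := hx
      rw [Finset.prod_eq_zero (Finset.mem_univ i) (Set.indicator_of_notMem hi _),
        ENNReal.ofReal_zero]
  rw [withDensity_apply _ (MeasurableSet.univ_pi hs), ← lintegral_indicator (.univ_pi hs)]
  simp_rw [hind]
  rw [← ofReal_integral_eq_lintegral_ofReal (by rw [volume_pi]; exact .fintype_prod hint)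
    (.of_forall fun x => Finset.prod_nonneg fun i _ => hnn i _),
    integral_fintype_prod_volume_eq_prod, ENNReal.ofReal_prod_of_nonneg fun i _ =>
      integral_nonneg (hnn i)]
  refine Finset.prod_congr rfl fun i _ => ?_
  rw [gaussianReal_apply_eq_integral _ (hv i), integral_indicator (hs i)]

section FiniteMoments

variable {Ω : Type*} [MeasurableSpace Ω]

/-- The algebra of the functions all of whose moments are finite. -/
def finiteMoments (μ : Measure Ω) [IsFiniteMeasure μ] : Subalgebra ℝ (Ω → ℝ) where
  carrier := {f | ∀ p : ℝ≥0, MemLp f p μ}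
  mul_mem' {f g} hf hg p := by
    have : ENNReal.HolderTriple ((2 * p : ℝ≥0) : ℝ≥0∞) ((2 * p : ℝ≥0) : ℝ≥0∞) (p : ℝ≥0∞) := by
      refine ⟨?_⟩
      rw [ENNReal.coe_mul, ENNReal.mul_inv (by simp) (by simp), ← add_mul, ENNReal.coe_ofNat,
        ENNReal.inv_two_add_inv_two, one_mul]
    exact (hg (2 * p)).mul (hf (2 * p))
  add_mem' hf hg p := (hf p).add (hg p)
  algebraMap_mem' c p := memLp_const c

variable {μ : Measure Ω} [IsFiniteMeasure μ]

theorem finiteMoments.integrable (f : finiteMoments μ) : Integrable f.1 μ :=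
  memLp_one_iff_integrable.1 (by simpa using f.2 1)

/-- The integral as a linear functional on the functions with finite moments. -/
noncomputable def finiteMoments.integral (μ : Measure Ω) [IsFiniteMeasure μ] :
    finiteMoments μ →ₗ[ℝ] ℝ where
  toFun f := ∫ ω, f.1 ω ∂μ
  map_add' f g := integral_add (finiteMoments.integrable f) (finiteMoments.integrable g)
  map_smul' c _ := integral_const_mul c _

/-- Evaluation at a point of the sample space. -/
def finiteMoments.eval (μ : Measure Ω) [IsFiniteMeasure μ] (ω : Ω) : finiteMoments μ →ₐ[ℝ] ℝ :=
  (Pi.evalAlgHom ℝ (fun _ : Ω => ℝ) ω).comp (finiteMoments μ).val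

theorem finiteMoments.eval_apply (f : finiteMoments μ) (ω : Ω) :
    finiteMoments.eval μ ω f = f.1 ω := rfl

theorem finiteMoments.comp_measurePreserving {Ω' : Type*} [MeasurableSpace Ω'] {ν : Measure Ω'}
    [IsFiniteMeasure ν] {g : Ω' → Ω} (hg : MeasurePreserving g ν μ) {f : Ω → ℝ}
    (hf : f ∈ finiteMoments μ) : (fun ω => f (g ω)) ∈ finiteMoments ν :=
  fun p => (hf p).comp_measurePreserving hg

theorem id_mem_finiteMoments_gaussianReal (m : ℝ) (v : ℝ≥0) :
    (fun x : ℝ => x) ∈ finiteMoments (gaussianReal m v) := fun p => memLp_id_gaussianReal p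

theorem eval_mem_finiteMoments_gaussianReal (m : ℝ) (v : ℝ≥0) (P : Polynomial ℝ) :
    (fun x : ℝ => P.eval x) ∈ finiteMoments (gaussianReal m v) := by
  convert (Polynomial.aeval
    (⟨_, id_mem_finiteMoments_gaussianReal m v⟩ : finiteMoments (gaussianReal m v)) P).2 using 1
  ext x
  have h := Polynomial.aeval_algHom_apply (finiteMoments.eval (gaussianReal m v) x)
    ⟨_, id_mem_finiteMoments_gaussianReal m v⟩ P
  rw [finiteMoments.eval_apply, finiteMoments.eval_apply, Polynomial.coe_aeval_eq_eval] at h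
  exact h

theorem integrable_eval_gaussianReal (m : ℝ) (v : ℝ≥0) (P : Polynomial ℝ) :
    Integrable (fun x : ℝ => P.eval x) (gaussianReal m v) :=
  finiteMoments.integrable ⟨_, eval_mem_finiteMoments_gaussianReal m v P⟩

end FiniteMoments

theorem hasDerivAt_linearMap_eval_mul {A : Type*} [CommRing A] [Algebra ℝ A] (E : A →ₗ[ℝ] ℝ)
    (P : Polynomial A) (a : A) (u : ℝ) :
    HasDerivAt (fun u : ℝ => E (P.eval (algebraMap ℝ A u) * a))
      (E (P.derivative.eval (algebraMap ℝ A u) * a)) u := by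
  induction P using Polynomial.induction_on' with
  | add p q hp hq => simpa only [Polynomial.eval_add, Polynomial.derivative_add, add_mul, map_add] using! hp.add hq
  | monomial n c =>
    have h : ∀ (r : ℝ) (b : A), E (b * algebraMap ℝ A r * a) = r * E (b * a) := fun r b => by
      rw [mul_comm b, mul_assoc, ← Algebra.smul_def, map_smul, smul_eq_mul]
    simp only [Polynomial.eval_monomial, Polynomial.derivative_monomial, ← map_pow, h]
    refine ((hasDerivAt_pow n u).mul_const (E (c * a))).congr_deriv ?_
    have hn : E ((n : A) * (c * a)) = n * E (c * a) := by
      rw [← nsmul_eq_mul, map_nsmul, nsmul_eq_mul]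
    rw [mul_right_comm c, mul_comm (c * a), hn]
    ring

section Gaussian

theorem integral_mul_eval_gaussianReal {v : ℝ≥0} (hv : v ≠ 0) (P : Polynomial ℝ) :
    ∫ x, x * P.eval x ∂(gaussianReal 0 v) = v * ∫ x, P.derivative.eval x ∂(gaussianReal 0 v) := by
  have hv' : (v : ℝ) ≠ 0 := by exact_mod_cast hv
  have hd : ∀ x, HasDerivAt (gaussianPDFReal 0 v) (-(x / v) * gaussianPDFReal 0 v x) x := fun x => by
    have h := ((((hasDerivAt_id x).pow 2).neg.div_const (2 * (v : ℝ))).exp).const_mul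
      (√(2 * Real.pi * v))⁻¹
    rw [gaussianPDFReal_def]
    simp only [id, sub_zero, Pi.neg_apply, Pi.pow_apply] at h ⊢
    refine h.congr_deriv ?_
    field_simp
    norm_num
  have hint : ∀ Q : Polynomial ℝ, Integrable (fun x => Q.eval x * gaussianPDFReal 0 v x) volume :=
    fun Q => by
      have h := integrable_eval_gaussianReal 0 v Q
      rw [gaussianReal_of_var_ne_zero _ hv, integrable_withDensity_iff_integrable_smul'
        (measurable_gaussianPDF _ _) (.of_forall fun _ => gaussianPDF_lt_top)] at h
      simpa [mul_comm, toReal_gaussianPDF] using h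
  have key := integral_mul_deriv_eq_deriv_mul_of_integrable (u := fun x => P.eval x)
    (u' := fun x => P.derivative.eval x) (v := gaussianPDFReal 0 v)
    (v' := fun x => -(x / v) * gaussianPDFReal 0 v x) (fun x _ => P.hasDerivAt x) (fun x _ => hd x)
    (by
      refine (hint (P * Polynomial.X * Polynomial.C (-(v : ℝ)⁻¹))).congr (.of_forall fun x => ?_)
      simp only [Polynomial.eval_mul, Polynomial.eval_X, Polynomial.eval_C, Pi.mul_apply]
      ring) (hint _) (hint _)
  rw [integral_gaussianReal_eq_integral_smul hv, integral_gaussianReal_eq_integral_smul hv,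
    ← integral_const_mul]
  have h2 : ∫ x, P.eval x * (-(x / v) * gaussianPDFReal 0 v x) =
      -(v : ℝ)⁻¹ * ∫ x, gaussianPDFReal 0 v x * (x * P.eval x) := by
    rw [← integral_const_mul]
    congr 1; ext x; ring
  rw [h2] at key
  simp only [smul_eq_mul, mul_comm (gaussianPDFReal 0 v _) (P.derivative.eval _)]
  rw [integral_const_mul, ← neg_inj, ← mul_neg, ← key, neg_mul, mul_neg, mul_inv_cancel_left₀ hv']

theorem integral_pow_add_two_gaussianReal {v : ℝ≥0} (hv : v ≠ 0) (n : ℕ) :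
    ∫ x, x ^ (n + 2) ∂(gaussianReal 0 v) = v * (n + 1) * ∫ x, x ^ n ∂(gaussianReal 0 v) := by
  have h := integral_mul_eval_gaussianReal hv (Polynomial.X ^ (n + 1))
  simp only [Polynomial.eval_pow, Polynomial.eval_X, Polynomial.derivative_X_pow,
    Polynomial.eval_mul, Polynomial.eval_C, integral_const_mul, Nat.add_sub_cancel] at h
  rw [mul_assoc]
  push_cast at h
  rw [← h]
  congr 1; ext x; ring

theorem coord_mem_finiteMoments_pi {ι : Type*} [Fintype ι] (m : ι → ℝ) (v : ι → ℝ≥0) (i : ι) :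
    (fun w : ι → ℝ => w i) ∈ finiteMoments (Measure.pi fun i => gaussianReal (m i) (v i)) :=
  finiteMoments.comp_measurePreserving
    (measurePreserving_eval (fun i => gaussianReal (m i) (v i)) i)
    (id_mem_finiteMoments_gaussianReal (m i) (v i))

variable {ι : Type*} [Fintype ι] [DecidableEq ι]

theorem integral_mul_pi_gaussianReal {v : ℝ≥0} (hv : v ≠ 0) (i j : ι) :
    ∫ w : ι → ℝ, w i * w j ∂(Measure.pi fun _ => gaussianReal 0 v) = if i = j then (v : ℝ) else 0 := by
  have hw : ∀ w : ι → ℝ, w i * w j =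
      ∏ m, w m ^ ((if m = i then 1 else 0) + (if m = j then 1 else 0)) := fun w => by
    simp only [pow_add, Finset.prod_mul_distrib]
    simp [pow_ite]
  simp_rw [hw]
  rw [integral_fintype_prod_eq_prod (fun m (x : ℝ) =>
    x ^ ((if m = i then 1 else 0) + (if m = j then 1 else 0)))]
  split_ifs with h
  · subst h
    rw [Finset.prod_eq_single i (fun b _ hb => by simp [hb]) (by simp)]
    simpa using integral_pow_add_two_gaussianReal hv 0
  · exact Finset.prod_eq_zero (Finset.mem_univ i) (by simp [h])

/-- Fourth mixed moments of independent centred Gaussian variables. -/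
theorem integral_mul_mul_mul_pi_gaussianReal {v : ℝ≥0} (hv : v ≠ 0) (i j k l : ι) :
    ∫ w : ι → ℝ, w i * w j * (w k * w l) ∂(Measure.pi fun _ => gaussianReal 0 v) =
      v ^ 2 * ((if i = j then 1 else 0) * (if k = l then 1 else 0) +
        (if i = k then 1 else 0) * (if j = l then 1 else 0) +
        (if i = l then 1 else 0) * (if j = k then 1 else 0)) := by
  have m0 : ∫ x, x ^ 0 ∂(gaussianReal 0 v) = 1 := by simp
  have m1 : ∫ x, x ^ 1 ∂(gaussianReal 0 v) = 0 := by simp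
  have m2 : ∫ x, x ^ 2 ∂(gaussianReal 0 v) = v := by
    have := integral_pow_add_two_gaussianReal hv 0; simpa using this
  have m3 : ∫ x, x ^ 3 ∂(gaussianReal 0 v) = 0 := by
    rw [integral_pow_add_two_gaussianReal hv 1, m1, mul_zero]
  have m4 : ∫ x, x ^ 4 ∂(gaussianReal 0 v) = 3 * v ^ 2 := by
    rw [integral_pow_add_two_gaussianReal hv 2, m2]; push_cast; ring
  let c : ι → ℕ := fun m => (if m = i then 1 else 0) + (if m = j then 1 else 0) +
    ((if m = k then 1 else 0) + (if m = l then 1 else 0))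
  have hw : ∀ w : ι → ℝ, w i * w j * (w k * w l) = ∏ m, w m ^ c m := fun w => by
    simp only [c, pow_add, Finset.prod_mul_distrib]
    simp [pow_ite]
  simp_rw [hw]
  rw [integral_fintype_prod_eq_prod (fun m (x : ℝ) => x ^ c m)]
  have hone : ∀ m, c m = 1 → ∏ m, ∫ x, x ^ c m ∂(gaussianReal 0 v) = 0 := fun m hm =>
    Finset.prod_eq_zero (Finset.mem_univ m) (by rw [hm, m1])
  have hthree : ∀ m, c m = 3 → ∏ m, ∫ x, x ^ c m ∂(gaussianReal 0 v) = 0 := fun m hm =>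
    Finset.prod_eq_zero (Finset.mem_univ m) (by rw [hm, m3])
  have hfour : ∀ m, c m = 4 → (∀ b, b ≠ m → c b = 0) →
      ∏ m, ∫ x, x ^ c m ∂(gaussianReal 0 v) = 3 * v ^ 2 := fun m hm hb => by
    rw [Finset.prod_eq_single m (fun b _ h => by rw [hb b h, m0]) (by simp), hm, m4]
  have htwo : ∀ m n, m ≠ n → c m = 2 → c n = 2 → (∀ b, b ≠ m → b ≠ n → c b = 0) →
      ∏ m, ∫ x, x ^ c m ∂(gaussianReal 0 v) = v ^ 2 := fun m n hmn hm hn hb => by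
    rw [Finset.prod_eq_mul m n hmn (fun b _ h => by rw [hb b h.1 h.2, m0]) (by simp) (by simp),
      hm, hn, m2, sq]
  by_cases hij : i = j <;> by_cases hkl : k = l <;> by_cases hik : i = k
  · rw [hfour i (by grind) (by grind)]; grind
  · rw [htwo i k hik (by grind) (by grind) (by grind)]; grind
  · rw [hone l (by grind)]; grind
  · rw [hone k (by grind)]; grind
  · rw [hone j (by grind)]; grind
  · rw [hone i (by grind)]; grind
  · by_cases hjl : j = l
    · rw [htwo i j hij (by grind) (by grind) (by grind)]; grind
    · rw [hone j (by grind)]; grind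
  · by_cases hil : i = l
    · by_cases hjk : j = k
      · rw [htwo i j hij (by grind) (by grind) (by grind)]; grind
      · rw [hone j (by grind)]; grind
    · rw [hone i (by grind)]; grind

/-- The quadratic form of a matrix. -/
def Matrix.quadForm {ι : Type*} [Fintype ι] (A : Matrix ι ι ℝ) (w : ι → ℝ) : ℝ := ∑ i, ∑ j, A i j * (w i * w j)

theorem Matrix.quadForm_mem_finiteMoments {ι : Type*} [Fintype ι] (A : Matrix ι ι ℝ) (m : ι → ℝ) (v : ι → ℝ≥0) :
    A.quadForm ∈ finiteMoments (Measure.pi fun i => gaussianReal (m i) (v i)) := by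
  have : A.quadForm = ∑ i, ∑ j, A i j • ((fun w : ι → ℝ => w i) * fun w => w j) := by
    ext w; simp [Matrix.quadForm]
  rw [this]
  exact sum_mem fun i _ => sum_mem fun j _ => Subalgebra.smul_mem _
    (mul_mem (coord_mem_finiteMoments_pi m v i) (coord_mem_finiteMoments_pi m v j)) _

theorem integral_quadForm_pi_gaussianReal {v : ℝ≥0} (hv : v ≠ 0) (A : Matrix ι ι ℝ) :
    ∫ w, A.quadForm w ∂(Measure.pi fun _ => gaussianReal 0 v) = v * A.trace := by
  have hi : ∀ i j : ι, Integrable (fun w : ι → ℝ => A i j * (w i * w j))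
      (Measure.pi fun _ => gaussianReal 0 v) := fun i j =>
    (finiteMoments.integrable ⟨_, mul_mem (coord_mem_finiteMoments_pi (fun _ => 0) (fun _ => v) i)
      (coord_mem_finiteMoments_pi _ _ j)⟩).const_mul _
  simp only [Matrix.quadForm]
  rw [integral_finsetSum _ fun i _ => integrable_finsetSum _ fun j _ => hi i j]
  simp_rw [integral_finsetSum _ fun j _ => hi _ j, integral_const_mul,
    integral_mul_pi_gaussianReal hv]
  simp [Matrix.trace, Finset.mul_sum, mul_comm]

theorem integral_quadForm_mul_quadForm_pi_gaussianReal {v : ℝ≥0} (hv : v ≠ 0) (A : Matrix ι ι ℝ)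
    {B : Matrix ι ι ℝ} (hB : B.IsSymm) :
    ∫ w, A.quadForm w * B.quadForm w ∂(Measure.pi fun _ => gaussianReal 0 v) =
      v ^ 2 * (A.trace * B.trace + 2 * (A * B).trace) := by
  have hc := coord_mem_finiteMoments_pi (fun _ : ι => 0) (fun _ => v)
  have hi : ∀ i j k l : ι, Integrable (fun w : ι → ℝ => A i j * B k l * (w i * w j * (w k * w l)))
      (Measure.pi fun _ => gaussianReal 0 v) := fun i j k l =>
    (finiteMoments.integrable ⟨_, mul_mem (mul_mem (hc i) (hc j))
      (mul_mem (hc k) (hc l))⟩).const_mul _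
  have he : ∀ w, A.quadForm w * B.quadForm w =
      ∑ i, ∑ j, ∑ k, ∑ l, A i j * B k l * (w i * w j * (w k * w l)) := fun w => by
    rw [Matrix.quadForm, Finset.sum_mul]
    refine Finset.sum_congr rfl fun i _ => ?_
    rw [Finset.sum_mul]
    refine Finset.sum_congr rfl fun j _ => ?_
    rw [Matrix.quadForm, Finset.mul_sum]
    refine Finset.sum_congr rfl fun k _ => ?_
    rw [Finset.mul_sum]
    exact Finset.sum_congr rfl fun l _ => by ring
  simp_rw [he]
  rw [integral_finsetSum _ fun i _ => integrable_finsetSum _ fun j _ =>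
    integrable_finsetSum _ fun k _ => integrable_finsetSum _ fun l _ => hi i j k l]
  simp_rw [integral_finsetSum _ fun j _ => integrable_finsetSum _ fun k _ =>
      integrable_finsetSum _ fun l _ => hi _ j k l,
    integral_finsetSum _ fun k _ => integrable_finsetSum _ fun l _ => hi _ _ k l,
    integral_finsetSum _ fun l _ => hi _ _ _ l, integral_const_mul,
    integral_mul_mul_mul_pi_gaussianReal hv]
  have hB' : ∀ i j, B i j = B j i := fun i j => hB.apply j i
  have e1 : A.trace * B.trace = ∑ i, ∑ j, ∑ k, ∑ l, A i j * B k l *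
      ((if i = j then 1 else 0) * (if k = l then 1 else 0)) := by
    simp [Matrix.trace, Finset.sum_mul_sum]
  have e2 : (A * B).trace = ∑ i, ∑ j, ∑ k, ∑ l, A i j * B k l *
      ((if i = k then 1 else 0) * (if j = l then 1 else 0)) := by
    simp [Matrix.trace, Matrix.mul_apply, hB']
  have e3 : (A * B).trace = ∑ i, ∑ j, ∑ k, ∑ l, A i j * B k l *
      ((if i = l then 1 else 0) * (if j = k then 1 else 0)) := by
    simp [Matrix.trace, Matrix.mul_apply]
  rw [two_mul, ← add_assoc]
  nth_rw 1 [e2]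
  rw [e1, e3]
  simp only [← Finset.sum_add_distrib, Finset.mul_sum]
  refine Finset.sum_congr rfl fun i _ => Finset.sum_congr rfl fun j _ =>
    Finset.sum_congr rfl fun k _ => Finset.sum_congr rfl fun l _ => by ring

end Gaussian

section UpperIdx

variable {k : ℕ}

/-- The position of an entry of the lower right block of a bordered matrix. -/
def UpperIdx.succ (p : UpperIdx k) : UpperIdx (k + 1) :=
  ⟨(p.1.1.succ, p.1.2.succ), Fin.succ_le_succ_iff.2 p.2⟩

/-- The positions in the first row. -/
def UpperIdx.row (j : Fin (k + 1)) : UpperIdx (k + 1) := ⟨(0, j), Fin.zero_le _⟩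

/-- Splitting the positions into the first row and the remaining block. -/
noncomputable def UpperIdx.sumEquiv (k : ℕ) : Fin (k + 1) ⊕ UpperIdx k ≃ UpperIdx (k + 1) :=
  Equiv.ofBijective (Sum.elim UpperIdx.row UpperIdx.succ) <| by
    constructor
    · rintro (i | ⟨⟨i, j⟩, h⟩) (i' | ⟨⟨i', j'⟩, h'⟩) <;>
        simp [UpperIdx.row, UpperIdx.succ, Fin.succ_ne_zero, (Fin.succ_ne_zero _).symm]
    · rintro ⟨⟨i, j⟩, h⟩
      induction i using Fin.cases with
      | zero => exact ⟨.inl j, rfl⟩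
      | succ i =>
        induction j using Fin.cases with
        | zero => exact absurd h (by simp)
        | succ j => exact ⟨.inr ⟨(i, j), Fin.succ_le_succ_iff.1 h⟩, rfl⟩

@[to_additive]
theorem UpperIdx.prod_succ {M : Type*} [CommMonoid M] (f : UpperIdx (k + 1) → M) :
    ∏ p, f p = f (.row 0) * ((∏ i : Fin k, f (.row i.succ)) * ∏ p : UpperIdx k, f p.succ) := by
  rw [← (UpperIdx.sumEquiv k).prod_comp, Fintype.prod_sum_type, Fin.prod_univ_succ, mul_assoc]
  rfl

theorem UpperIdx.card (n : ℕ) : Fintype.card (UpperIdx n) = n * (n + 1) / 2 := by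
  have h : ∀ n, 2 * Fintype.card (UpperIdx n) = n * (n + 1) := fun n => by
    induction n with
    | zero => simp
    | succ n ih =>
      rw [← Fintype.card_congr (UpperIdx.sumEquiv n), Fintype.card_sum, mul_add, ih,
        Fintype.card_fin]
      ring
  rw [← h, Nat.mul_div_cancel_left _ two_pos]

theorem UpperIdx.prod_ite_diag (n : ℕ) (c : ℝ) :
    ∏ p : UpperIdx n, (if p.1.1 = p.1.2 then c else 1) = c ^ n := by
  induction n with
  | zero => simp
  | succ n ih =>
    rw [UpperIdx.prod_succ, pow_succ', ← ih]
    simp [UpperIdx.row, UpperIdx.succ, (Fin.succ_ne_zero _).symm]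

theorem UpperIdx.sum_eq_of_symm {n : ℕ} (f : Fin n → Fin n → ℝ) (hf : ∀ i j, f i j = f j i) :
    ∑ i, ∑ j, f i j = ∑ p : UpperIdx n, (if p.1.1 = p.1.2 then 1 else 2) * f p.1.1 p.1.2 := by
  induction n with
  | zero => simp
  | succ n ih =>
    have := ih (fun i j => f i.succ j.succ) fun i j => hf _ _
    rw [UpperIdx.sum_succ]
    simp only [UpperIdx.row, UpperIdx.succ, (Fin.succ_ne_zero _).symm, Fin.succ_inj, if_true,
      if_false, ← this, Fin.sum_univ_succ, Finset.sum_add_distrib, ← Finset.mul_sum]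
    simp_rw [fun i : Fin n => hf i.succ 0]
    ring

end UpperIdx

/-- The law of the entries on and above the diagonal of a `GOE` matrix. -/
noncomputable abbrev upperGaussian (k : ℕ) : Measure (UpperIdx k → ℝ) :=
  Measure.pi fun p => gaussianReal 0 (if p.1.1 = p.1.2 then 1 else 1 / 2)

theorem prod_gaussianPDFReal_upper {k : ℕ} (x : UpperIdx k → ℝ) :
    ∏ p : UpperIdx k, gaussianPDFReal 0 (if p.1.1 = p.1.2 then 1 else 1 / 2) (x p) =
      1 / (√2 ^ k * √Real.pi ^ (k * (k + 1) / 2)) *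
        Real.exp (-((SymMat.ofUpper x).frobenius ^ 2) / 2) := by
  have htr : ((SymMat.ofUpper x).1 * (SymMat.ofUpper x).1).trace =
      ∑ p : UpperIdx k, (if p.1.1 = p.1.2 then 1 else 2) * x p ^ 2 := by
    have h := UpperIdx.sum_eq_of_symm (fun i j => (SymMat.ofUpper x).1 i j ^ 2)
      fun i j => by rw [(SymMat.ofUpper x).2.apply]
    have h2 : ((SymMat.ofUpper x).1 * (SymMat.ofUpper x).1).trace =
        ∑ i, ∑ j, (SymMat.ofUpper x).1 i j ^ 2 := by
      simp only [Matrix.trace, Matrix.diag, Matrix.mul_apply]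
      refine Finset.sum_congr rfl fun i _ => Finset.sum_congr rfl fun j _ => ?_
      rw [(SymMat.ofUpper x).2.apply i j, sq]
    rw [h2, h]
    refine Finset.sum_congr rfl fun p _ => ?_
    simp [SymMat.ofUpper, min_eq_left p.2, max_eq_right p.2]
  have hnn : 0 ≤ ((SymMat.ofUpper x).1 * (SymMat.ofUpper x).1).trace := by
    rw [htr]
    exact Finset.sum_nonneg fun p _ => mul_nonneg (by split_ifs <;> norm_num) (sq_nonneg _)
  rw [SymMat.frobenius, Real.sq_sqrt hnn, htr]
  have hp : ∀ p : UpperIdx k, gaussianPDFReal 0 (if p.1.1 = p.1.2 then 1 else 1 / 2) (x p) =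
      (√Real.pi)⁻¹ * (if p.1.1 = p.1.2 then (√2)⁻¹ else 1) *
        Real.exp (-((if p.1.1 = p.1.2 then 1 else 2) * x p ^ 2) / 2) := fun p => by
    rw [gaussianPDFReal]
    split_ifs
    · simp [mul_comm]
    · simp [mul_comm, div_eq_mul_inv]
  simp_rw [hp]
  rw [Finset.prod_mul_distrib, Finset.prod_mul_distrib, UpperIdx.prod_ite_diag,
    ← Real.exp_sum, Finset.prod_const, Finset.card_univ, UpperIdx.card, ← Finset.sum_div,
    Finset.sum_neg_distrib, one_div, mul_inv, inv_pow, inv_pow]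
  ring

theorem SymMat.measurable_apply {k : ℕ} (i j : Fin k) : Measurable fun Q : SymMat k => Q.1 i j :=
  (measurable_pi_apply (i, j)).comp
    (comap_measurable fun (A : SymMat k) (p : Fin k × Fin k) => A.1 p.1 p.2)

theorem SymMat.measurable_frobenius (k : ℕ) : Measurable (SymMat.frobenius (n := k)) := by
  refine Measurable.sqrt ?_
  simp only [Matrix.trace, Matrix.diag, Matrix.mul_apply]
  exact Finset.measurable_fun_sum _ fun i _ => Finset.measurable_fun_sum _ fun j _ =>
    (SymMat.measurable_apply i j).mul (SymMat.measurable_apply j i)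

theorem GOE_eq_map (k : ℕ) : GOE k = (upperGaussian k).map SymMat.ofUpper := by
  have hm : Measurable fun A : SymMat k => ENNReal.ofReal
      (1 / (√2 ^ k * √Real.pi ^ (k * (k + 1) / 2)) * Real.exp (-(A.frobenius ^ 2) / 2)) :=
    ((((SymMat.measurable_frobenius k).pow_const 2).neg.div_const 2).exp.const_mul _).ennreal_ofReal
  rw [upperGaussian, pi_gaussianReal_eq_withDensity _ _ fun p => by split_ifs <;> simp]
  simp_rw [prod_gaussianPDFReal_upper]
  ext s hs
  rw [GOE, SymMat.lebesgue, withDensity_apply _ hs,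
    setLIntegral_map hs hm (SymMat.measurable_ofUpper k),
    Measure.map_apply (SymMat.measurable_ofUpper k) hs,
    withDensity_apply _ (SymMat.measurable_ofUpper k hs)]

section Border

variable {k : ℕ}

/-- The upper entries of the matrix with upper left entry `y.1`, the rest of the first row `y.2.1`,
and remaining block with upper entries `y.2.2`. -/
noncomputable def border (y : ℝ × (Fin k → ℝ) × (UpperIdx k → ℝ)) : UpperIdx (k + 1) → ℝ :=
  fun p => Sum.elim (Fin.cons y.1 y.2.1 : Fin (k + 1) → ℝ) y.2.2 ((UpperIdx.sumEquiv k).symm p)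

theorem border_row_zero (y : ℝ × (Fin k → ℝ) × (UpperIdx k → ℝ)) : border y (.row 0) = y.1 := by
  have : (UpperIdx.sumEquiv k).symm (.row 0) = .inl 0 := (Equiv.symm_apply_eq _).2 rfl
  simp [border, this]

theorem border_row_succ (y : ℝ × (Fin k → ℝ) × (UpperIdx k → ℝ)) (i : Fin k) :
    border y (.row i.succ) = y.2.1 i := by
  have : (UpperIdx.sumEquiv k).symm (.row i.succ) = .inl i.succ := (Equiv.symm_apply_eq _).2 rfl
  simp [border, this]

theorem border_succ (y : ℝ × (Fin k → ℝ) × (UpperIdx k → ℝ)) (p : UpperIdx k) :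
    border y p.succ = y.2.2 p := by
  have : (UpperIdx.sumEquiv k).symm p.succ = .inr p := (Equiv.symm_apply_eq _).2 rfl
  simp [border, this]

theorem UpperIdx.forall_succ {P : UpperIdx (k + 1) → Prop} :
    (∀ p, P p) ↔ P (.row 0) ∧ (∀ i : Fin k, P (.row i.succ)) ∧ ∀ p : UpperIdx k, P p.succ := by
  rw [← (UpperIdx.sumEquiv k).forall_congr_right, Sum.forall, Fin.forall_fin_succ, and_assoc]
  rfl

theorem measurePreserving_border (k : ℕ) :
    MeasurePreserving (border (k := k))
      ((gaussianReal 0 1).prod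
        ((Measure.pi fun _ : Fin k => gaussianReal 0 (1 / 2)).prod (upperGaussian k)))
      (upperGaussian (k + 1)) := by
  have hm : Measurable (border (k := k)) := by
    rw [measurable_pi_iff, UpperIdx.forall_succ]
    simp only [border_row_zero, border_row_succ, border_succ]
    exact ⟨by fun_prop, fun i => by fun_prop, fun p => by fun_prop⟩
  refine ⟨hm, (Measure.pi_eq fun s hs => ?_).symm⟩
  have hpre : border ⁻¹' Set.univ.pi s = s (.row 0) ×ˢ
      ((Set.univ.pi fun i : Fin k => s (.row i.succ)) ×ˢ
        Set.univ.pi fun p : UpperIdx k => s p.succ) := by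
    ext y
    simp only [Set.mem_preimage, Set.mem_univ_pi, Set.mem_prod]
    rw [UpperIdx.forall_succ]
    simp only [border_row_zero, border_row_succ, border_succ]
  rw [Measure.map_apply hm (.univ_pi hs), hpre, Measure.prod_prod, Measure.prod_prod,
    Measure.pi_pi, Measure.pi_pi, UpperIdx.prod_succ]
  simp [UpperIdx.row, UpperIdx.succ, (Fin.succ_ne_zero _).symm]

theorem ofUpper_border_zero_zero (y : ℝ × (Fin k → ℝ) × (UpperIdx k → ℝ)) :
    (SymMat.ofUpper (border y)).1 0 0 = y.1 := border_row_zero y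

theorem ofUpper_border_zero_succ (y : ℝ × (Fin k → ℝ) × (UpperIdx k → ℝ)) (i : Fin k) :
    (SymMat.ofUpper (border y)).1 0 i.succ = y.2.1 i := by
  rw [← border_row_succ y i]
  simp [SymMat.ofUpper, UpperIdx.row]

theorem ofUpper_border_succ_zero (y : ℝ × (Fin k → ℝ) × (UpperIdx k → ℝ)) (i : Fin k) :
    (SymMat.ofUpper (border y)).1 i.succ 0 = y.2.1 i := by
  rw [(SymMat.ofUpper (border y)).2.apply, ofUpper_border_zero_succ]

theorem ofUpper_border_submatrix (y : ℝ × (Fin k → ℝ) × (UpperIdx k → ℝ)) :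
    (SymMat.ofUpper (border y)).1.submatrix Fin.succ Fin.succ = (SymMat.ofUpper y.2.2).1 := by
  ext i j
  simp only [SymMat.ofUpper, Matrix.submatrix_apply, Matrix.of_apply]
  rw [← border_succ y]
  congr 1
  ext1
  rcases le_total i j with h | h <;> simp [UpperIdx.succ, h]

theorem eval_charpoly_ofUpper_border (y : ℝ × (Fin k → ℝ) × (UpperIdx k → ℝ)) (a : ℝ) :
    (SymMat.ofUpper (border y)).1.charpoly.eval a =
      (a - y.1) * (SymMat.ofUpper y.2.2).1.charpoly.eval a -
        (Matrix.scalar (Fin k) a - (SymMat.ofUpper y.2.2).1).adjugate.quadForm y.2.1 := by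
  rw [Matrix.eval_charpoly_succ, ofUpper_border_submatrix, ofUpper_border_zero_zero]
  simp only [ofUpper_border_zero_succ, ofUpper_border_succ_zero, Matrix.quadForm]
  congr 1
  exact Finset.sum_congr rfl fun i _ => Finset.sum_congr rfl fun j _ => by ring

end Border

/-- Evaluation of the characteristic polynomial of a matrix of random variables. -/
theorem finiteMoments.eval_charpoly {Ω : Type*} [MeasurableSpace Ω] {μ : Measure Ω}
    [IsFiniteMeasure μ] {k : ℕ} (M : Matrix (Fin k) (Fin k) (finiteMoments μ))
    (g : finiteMoments μ) (ω : Ω) :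
    (M.charpoly.eval g).1 ω = (M.map fun f => f.1 ω).charpoly.eval (g.1 ω) := by
  have h := Matrix.charpoly_map M (finiteMoments.eval μ ω : finiteMoments μ →+* ℝ)
  change _ = (M.map (finiteMoments.eval μ ω : finiteMoments μ →+* ℝ)).charpoly.eval _
  rw [h, Polynomial.eval_map]
  exact (Polynomial.eval₂_at_apply (finiteMoments.eval μ ω : finiteMoments μ →+* ℝ) g).symm

theorem finiteMoments.eval_derivative_charpoly {Ω : Type*} [MeasurableSpace Ω] {μ : Measure Ω}
    [IsFiniteMeasure μ] {k : ℕ} (M : Matrix (Fin k) (Fin k) (finiteMoments μ))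
    (g : finiteMoments μ) (ω : Ω) :
    (M.charpoly.derivative.eval g).1 ω =
      (M.map fun f => f.1 ω).charpoly.derivative.eval (g.1 ω) := by
  have h := Matrix.charpoly_map M (finiteMoments.eval μ ω : finiteMoments μ →+* ℝ)
  change _ = (M.map (finiteMoments.eval μ ω : finiteMoments μ →+* ℝ)).charpoly.derivative.eval _
  rw [h, Polynomial.derivative_map, Polynomial.eval_map]
  exact (Polynomial.eval₂_at_apply (finiteMoments.eval μ ω : finiteMoments μ →+* ℝ) g).symm

theorem charpoly_mem_finiteMoments_upperGaussian (k : ℕ) (a : ℝ) :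
    (fun x : UpperIdx k → ℝ => (SymMat.ofUpper x).1.charpoly.eval a) ∈
      finiteMoments (upperGaussian k) := by
  let M : Matrix (Fin k) (Fin k) (finiteMoments (upperGaussian k)) := Matrix.of fun i j =>
    ⟨fun x => x ⟨(min i j, max i j), min_le_max⟩, coord_mem_finiteMoments_pi _ _ _⟩
  convert (M.charpoly.eval (algebraMap ℝ _ a)).2 using 1
  ext x
  rw [finiteMoments.eval_charpoly]
  rfl

/-- The law of a Gaussian scalar shift together with the upper entries of a `GOE` matrix. -/
noncomputable abbrev shiftedGaussian (k : ℕ) : Measure (ℝ × (UpperIdx k → ℝ)) :=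
  (gaussianReal 0 (1 / 2)).prod (upperGaussian k)

/-- The scalar shift as a random variable. -/
noncomputable def shiftVar (k : ℕ) : finiteMoments (shiftedGaussian k) :=
  ⟨fun ω => ω.1, finiteMoments.comp_measurePreserving measurePreserving_fst
    (id_mem_finiteMoments_gaussianReal _ _)⟩

/-- The `GOE` matrix as a matrix of random variables. -/
noncomputable def matVar (k : ℕ) : Matrix (Fin k) (Fin k) (finiteMoments (shiftedGaussian k)) :=
  Matrix.of fun i j => ⟨fun ω => ω.2 ⟨(min i j, max i j), min_le_max⟩,
    finiteMoments.comp_measurePreserving measurePreserving_snd (coord_mem_finiteMoments_pi _ _ _)⟩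

/-- The shifted characteristic polynomial, as a polynomial with random coefficients. -/
noncomputable def shiftedCharpoly (k : ℕ) : Polynomial (finiteMoments (shiftedGaussian k)) :=
  (matVar k).charpoly.comp (Polynomial.X + Polynomial.C (shiftVar k))

theorem eval_shiftedCharpoly (k : ℕ) (u : ℝ) (ω : ℝ × (UpperIdx k → ℝ)) :
    ((shiftedCharpoly k).eval (algebraMap ℝ _ u)).1 ω =
      (SymMat.ofUpper ω.2).1.charpoly.eval (u + ω.1) := by
  rw [shiftedCharpoly, Polynomial.eval_comp, finiteMoments.eval_charpoly]
  simp only [Polynomial.eval_add, Polynomial.eval_X, Polynomial.eval_C]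
  rfl

theorem eval_derivative_shiftedCharpoly (k : ℕ) (u : ℝ) (ω : ℝ × (UpperIdx k → ℝ)) :
    ((shiftedCharpoly k).derivative.eval (algebraMap ℝ _ u)).1 ω =
      (SymMat.ofUpper ω.2).1.charpoly.derivative.eval (u + ω.1) := by
  rw [shiftedCharpoly, Polynomial.derivative_comp]
  simp only [Polynomial.derivative_add, Polynomial.derivative_X, Polynomial.derivative_C, add_zero,
    one_mul, Polynomial.eval_comp]
  rw [finiteMoments.eval_derivative_charpoly]
  simp only [Polynomial.eval_add, Polynomial.eval_X, Polynomial.eval_C]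
  rfl

/-- Integrating out the first row of a `GOE` matrix. -/
theorem integral_charpoly_mul_charpoly_succ (k : ℕ) (a b : ℝ) :
    (a - b) * ∫ x, (SymMat.ofUpper x).1.charpoly.eval a * (SymMat.ofUpper x).1.charpoly.eval b
        ∂(upperGaussian (k + 1)) =
      ∫ x, ((a - b) * ((1 + a * b) * ((SymMat.ofUpper x).1.charpoly.eval a *
          (SymMat.ofUpper x).1.charpoly.eval b) -
        1 / 2 * (a * ((SymMat.ofUpper x).1.charpoly.eval a *
            (SymMat.ofUpper x).1.charpoly.derivative.eval b) +
          b * ((SymMat.ofUpper x).1.charpoly.derivative.eval a *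
            (SymMat.ofUpper x).1.charpoly.eval b)) +
        1 / 4 * ((SymMat.ofUpper x).1.charpoly.derivative.eval a *
          (SymMat.ofUpper x).1.charpoly.derivative.eval b)) +
        1 / 2 * ((SymMat.ofUpper x).1.charpoly.eval a *
            (SymMat.ofUpper x).1.charpoly.derivative.eval b -
          (SymMat.ofUpper x).1.charpoly.derivative.eval a *
            (SymMat.ofUpper x).1.charpoly.eval b)) ∂(upperGaussian k) := by
  have hint : Integrable (fun x : UpperIdx (k + 1) → ℝ => (SymMat.ofUpper x).1.charpoly.eval a *
      (SymMat.ofUpper x).1.charpoly.eval b) (upperGaussian (k + 1)) :=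
    finiteMoments.integrable ⟨_, mul_mem (charpoly_mem_finiteMoments_upperGaussian (k + 1) a)
      (charpoly_mem_finiteMoments_upperGaussian (k + 1) b)⟩
  have hb := measurePreserving_border k
  have hint' := hb.integrable_comp_of_integrable hint
  simp only [Function.comp_def] at hint'
  rw [← hb.map_eq] at hint ⊢
  rw [integral_map hb.measurable.aemeasurable hint.aestronglyMeasurable,
    integral_prod_symm _ hint', integral_prod_symm _ hint'.integral_prod_right]
  rw [← integral_const_mul]
  refine integral_congr_ae (.of_forall fun x => ?_)
  simp only [eval_charpoly_ofUpper_border]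
  set χ := (SymMat.ofUpper x).1.charpoly with hχ
  set A := (Matrix.scalar (Fin k) a - (SymMat.ofUpper x).1).adjugate with hA
  set B := (Matrix.scalar (Fin k) b - (SymMat.ofUpper x).1).adjugate with hB
  have hBs : B.IsSymm := by
    refine Matrix.IsSymm.adjugate ?_
    exact (Matrix.isSymm_diagonal _).sub (SymMat.ofUpper x).2
  have hq : ∀ w : Fin k → ℝ,
      ∫ q, ((a - q) * χ.eval a - A.quadForm w) * ((b - q) * χ.eval b - B.quadForm w)
        ∂(gaussianReal 0 1) =
      (1 + a * b) * (χ.eval a * χ.eval b) - a * χ.eval a * B.quadForm w -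
        b * χ.eval b * A.quadForm w + A.quadForm w * B.quadForm w := fun w => by
    have h1 : Integrable (fun q : ℝ => q) (gaussianReal 0 1) := by
      simpa using integrable_eval_gaussianReal 0 1 Polynomial.X
    have h2 : Integrable (fun q : ℝ => q ^ 2) (gaussianReal 0 1) :=
      (integrable_eval_gaussianReal 0 1 (Polynomial.X ^ 2)).congr (.of_forall fun q => by simp)
    have h3 (r t : ℝ) : Integrable (fun q : ℝ => r * q ^ 2 + t * q) (gaussianReal 0 1) :=
      (h2.const_mul r).add (h1.const_mul t)
    have m1 : ∫ q, q ∂(gaussianReal 0 1) = 0 := integral_id_gaussianReal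
    have m2 : ∫ q, q ^ 2 ∂(gaussianReal 0 1) = 1 := by
      simpa using integral_pow_add_two_gaussianReal one_ne_zero 0
    have he : ∀ q : ℝ,
        ((a - q) * χ.eval a - A.quadForm w) * ((b - q) * χ.eval b - B.quadForm w) =
        (χ.eval a * χ.eval b) * q ^ 2 +
        (χ.eval a * B.quadForm w + χ.eval b * A.quadForm w - (a + b) * (χ.eval a * χ.eval b)) * q +
        (a * χ.eval a - A.quadForm w) * (b * χ.eval b - B.quadForm w) := fun q => by ring
    simp_rw [he]
    rw [integral_add (h3 _ _) (integrable_const _),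
      integral_add (h2.const_mul _) (h1.const_mul _), integral_const_mul, integral_const_mul,
      m1, m2]
    simp
    ring
  simp_rw [hq]
  have hv : (1 / 2 : ℝ≥0) ≠ 0 := by simp
  have mA := A.quadForm_mem_finiteMoments (fun _ => 0) (fun _ => 1 / 2)
  have mB := B.quadForm_mem_finiteMoments (fun _ => 0) (fun _ => 1 / 2)
  have iA : Integrable A.quadForm (Measure.pi fun _ => gaussianReal 0 (1 / 2)) :=
    finiteMoments.integrable ⟨_, mA⟩
  have iB : Integrable B.quadForm (Measure.pi fun _ => gaussianReal 0 (1 / 2)) :=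
    finiteMoments.integrable ⟨_, mB⟩
  have iAB : Integrable (fun w => A.quadForm w * B.quadForm w)
      (Measure.pi fun _ => gaussianReal 0 (1 / 2)) := finiteMoments.integrable ⟨_, mul_mem mA mB⟩
  have i1 (c r : ℝ) : Integrable (fun w => c - r * B.quadForm w)
      (Measure.pi fun _ => gaussianReal 0 (1 / 2)) := (integrable_const c).sub (iB.const_mul r)
  have i2 (c r t : ℝ) : Integrable (fun w => c - r * B.quadForm w - t * A.quadForm w)
      (Measure.pi fun _ => gaussianReal 0 (1 / 2)) := (i1 c r).sub (iA.const_mul t)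
  rw [integral_add (i2 _ _ _) iAB, integral_sub (i1 _ _) (iA.const_mul _),
    integral_sub (integrable_const _) (iB.const_mul _), integral_const, integral_const_mul,
    integral_const_mul, integral_quadForm_pi_gaussianReal hv, integral_quadForm_pi_gaussianReal hv,
    integral_quadForm_mul_quadForm_pi_gaussianReal hv A hBs]
  have hT := Matrix.sub_mul_trace_adjugate_mul_adjugate (SymMat.ofUpper x).1 a b
  rw [← hA, ← hB, ← hχ] at hT
  rw [hA, hB, Matrix.trace_adjugate_scalar_sub, Matrix.trace_adjugate_scalar_sub, ← hA, ← hB, ← hχ]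
  simp only [probReal_univ, smul_eq_mul, one_mul]
  push_cast
  linear_combination (1 / 2) * hT

open Polynomial in
/-- Integrating by parts in the shift. -/
theorem integral_shift_by_parts (χ : ℝ[X]) (u v : ℝ) :
    ∫ s, ((u - v) * ((1 + (u + s) * (v + s)) * (χ.eval (u + s) * χ.eval (v + s)) -
        1 / 2 * ((u + s) * (χ.eval (u + s) * χ.derivative.eval (v + s)) +
          (v + s) * (χ.derivative.eval (u + s) * χ.eval (v + s))) +
        1 / 4 * (χ.derivative.eval (u + s) * χ.derivative.eval (v + s))) +
        1 / 2 * (χ.eval (u + s) * χ.derivative.eval (v + s) -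
          χ.derivative.eval (u + s) * χ.eval (v + s))) ∂(gaussianReal 0 (1 / 2)) =
    ∫ s, ((u - v) * ((3 / 2 + u * v) * (χ.eval (u + s) * χ.eval (v + s)) +
        1 / 2 * (u * (χ.derivative.eval (u + s) * χ.eval (v + s)) +
          v * (χ.eval (u + s) * χ.derivative.eval (v + s))) +
        1 / 4 * (χ.derivative.eval (u + s) * χ.derivative.eval (v + s))) +
        1 / 2 * (χ.eval (u + s) * χ.derivative.eval (v + s) -
          χ.derivative.eval (u + s) * χ.eval (v + s))) ∂(gaussianReal 0 (1 / 2)) := by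
  let α := χ.comp (C u + X)
  let β := χ.comp (C v + X)
  let α' := χ.derivative.comp (C u + X)
  let β' := χ.derivative.comp (C v + X)
  let P : ℝ[X] := C (u - v) * ((C (u + v) + X) * (α * β))
  let H : ℝ[X] := C (u - v) * (C (3 / 2 + u * v) * (α * β) +
    C (1 / 2) * (C u * (α' * β) + C v * (α * β')) + C (1 / 4) * (α' * β')) +
    C (1 / 2) * (α * β' - α' * β)
  have hH : ∀ s, H.eval s = (u - v) * ((3 / 2 + u * v) * (χ.eval (u + s) * χ.eval (v + s)) +
        1 / 2 * (u * (χ.derivative.eval (u + s) * χ.eval (v + s)) +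
          v * (χ.eval (u + s) * χ.derivative.eval (v + s))) +
        1 / 4 * (χ.derivative.eval (u + s) * χ.derivative.eval (v + s))) +
        1 / 2 * (χ.eval (u + s) * χ.derivative.eval (v + s) -
          χ.derivative.eval (u + s) * χ.eval (v + s)) := fun s => by
    simp [H, α, β, α', β']
  have hS := integral_mul_eval_gaussianReal (v := 1 / 2) (by simp) P
  simp_rw [← hH]
  have hi := integrable_eval_gaussianReal 0 (1 / 2)
  have hXP : Integrable (fun s => s * P.eval s) (gaussianReal 0 (1 / 2)) := 
    (hi (X * P)).congr (.of_forall fun s => eval_mul.trans (by rw [eval_X]))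
  have hz : ∫ s, (s * P.eval s - 1 / 2 * P.derivative.eval s) ∂(gaussianReal 0 (1 / 2)) = 0 := by
    rw [integral_sub hXP ((hi P.derivative).const_mul _), integral_const_mul, hS]
    simp
  refine Eq.trans ?_ ((integral_add (hi H) (hXP.sub ((hi P.derivative).const_mul (1 / 2)))).trans
    ((congrArg _ hz).trans (add_zero _)))
  refine integral_congr_ae (.of_forall fun s => ?_)
  have hP : P.eval s = (u - v) * ((u + v + s) * (χ.eval (u + s) * χ.eval (v + s))) := by
    simp [P, α, β]
  have hP' : P.derivative.eval s = (u - v) * (χ.eval (u + s) * χ.eval (v + s) + (u + v + s) *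
      (χ.derivative.eval (u + s) * χ.eval (v + s) +
        χ.eval (u + s) * χ.derivative.eval (v + s))) := by
    simp [P, α, β, derivative_comp]
  simp only [hH, Pi.sub_apply, hP, hP']
  ring

theorem integrable_charpoly_mul_charpoly_shifted (k : ℕ) (u v : ℝ) :
    Integrable (fun ω : ℝ × (UpperIdx k → ℝ) => (SymMat.ofUpper ω.2).1.charpoly.eval (u + ω.1) *
      (SymMat.ofUpper ω.2).1.charpoly.eval (v + ω.1)) (shiftedGaussian k) := by
  have h := finiteMoments.integrable ((shiftedCharpoly k).eval (algebraMap ℝ _ u) *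
    (shiftedCharpoly k).eval (algebraMap ℝ _ v))
  simpa only [Subalgebra.coe_mul, Pi.mul_def, eval_shiftedCharpoly] using! h

theorem integral_charpoly_mul_charpoly_shifted_eq (k : ℕ) (u v : ℝ) :
    finiteMoments.integral (shiftedGaussian k) ((shiftedCharpoly k).eval (algebraMap ℝ _ u) *
      (shiftedCharpoly k).eval (algebraMap ℝ _ v)) =
    ∫ s, ∫ x, (SymMat.ofUpper x).1.charpoly.eval (u + s) *
      (SymMat.ofUpper x).1.charpoly.eval (v + s) ∂(upperGaussian k) ∂(gaussianReal 0 (1 / 2)) := by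
  rw [integral_integral (integrable_charpoly_mul_charpoly_shifted k u v)]
  refine integral_congr_ae (.of_forall fun ω => ?_)
  simp only [Subalgebra.coe_mul, Pi.mul_apply, eval_shiftedCharpoly]

/-- The recursion in the size of the matrix for the shifted determinantal correlations. -/
theorem integral_shiftedCharpoly_succ (k : ℕ) (u v : ℝ) :
    (u - v) * finiteMoments.integral (shiftedGaussian (k + 1))
      ((shiftedCharpoly (k + 1)).eval (algebraMap ℝ _ u) *
        (shiftedCharpoly (k + 1)).eval (algebraMap ℝ _ v)) =
    finiteMoments.integral (shiftedGaussian k)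
      ((u - v) • ((3 / 2 + u * v) • ((shiftedCharpoly k).eval (algebraMap ℝ _ u) *
          (shiftedCharpoly k).eval (algebraMap ℝ _ v)) +
        (1 / 2 : ℝ) • (u • ((shiftedCharpoly k).derivative.eval (algebraMap ℝ _ u) *
            (shiftedCharpoly k).eval (algebraMap ℝ _ v)) +
          v • ((shiftedCharpoly k).eval (algebraMap ℝ _ u) *
            (shiftedCharpoly k).derivative.eval (algebraMap ℝ _ v))) +
        (1 / 4 : ℝ) • ((shiftedCharpoly k).derivative.eval (algebraMap ℝ _ u) *
          (shiftedCharpoly k).derivative.eval (algebraMap ℝ _ v))) +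
        (1 / 2 : ℝ) • ((shiftedCharpoly k).eval (algebraMap ℝ _ u) *
            (shiftedCharpoly k).derivative.eval (algebraMap ℝ _ v) -
          (shiftedCharpoly k).derivative.eval (algebraMap ℝ _ u) *
            (shiftedCharpoly k).eval (algebraMap ℝ _ v))) := by
  rw [integral_charpoly_mul_charpoly_shifted_eq, ← integral_const_mul]
  have h1 := fun s => integral_charpoly_mul_charpoly_succ k (u + s) (v + s)
  simp only [add_sub_add_right_eq_sub] at h1
  simp_rw [h1]
  let p := shiftedCharpoly k
  let c : ℝ → finiteMoments (shiftedGaussian k) := algebraMap ℝ _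
  let S := shiftVar k
  have hS : ∀ ω, S.1 ω = ω.1 := fun ω => rfl
  have hc : ∀ r ω, (c r).1 ω = r := fun r ω => rfl
  have i1 := finiteMoments.integrable
    ((u - v) • ((1 + (c u + S) * (c v + S)) * (p.eval (c u) * p.eval (c v)) -
        (1 / 2 : ℝ) • ((c u + S) * (p.eval (c u) * p.derivative.eval (c v)) +
          (c v + S) * (p.derivative.eval (c u) * p.eval (c v))) +
        (1 / 4 : ℝ) • (p.derivative.eval (c u) * p.derivative.eval (c v))) +
        (1 / 2 : ℝ) • (p.eval (c u) * p.derivative.eval (c v) -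
          p.derivative.eval (c u) * p.eval (c v)))
  have i2 := finiteMoments.integrable
    ((u - v) • ((3 / 2 + u * v) • (p.eval (c u) * p.eval (c v)) +
        (1 / 2 : ℝ) • (u • (p.derivative.eval (c u) * p.eval (c v)) +
          v • (p.eval (c u) * p.derivative.eval (c v))) +
        (1 / 4 : ℝ) • (p.derivative.eval (c u) * p.derivative.eval (c v))) +
        (1 / 2 : ℝ) • (p.eval (c u) * p.derivative.eval (c v) -
          p.derivative.eval (c u) * p.eval (c v)))
  have e0 : ∀ r ω, (p.eval (c r)).1 ω = (SymMat.ofUpper ω.2).1.charpoly.eval (r + ω.1) :=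
    fun r ω => eval_shiftedCharpoly k r ω
  have e1 : ∀ r ω, (p.derivative.eval (c r)).1 ω =
      (SymMat.ofUpper ω.2).1.charpoly.derivative.eval (r + ω.1) :=
    fun r ω => eval_derivative_shiftedCharpoly k r ω
  rw [integral_integral_swap (i1.congr (.of_forall fun ω => ?_))]
  · simp_rw [integral_shift_by_parts]
    change _ = ∫ ω, _ ∂((gaussianReal 0 (1 / 2)).prod (upperGaussian k))
    rw [integral_prod_symm _ i2]
    refine integral_congr_ae (.of_forall fun x => integral_congr_ae (.of_forall fun s => ?_))
    simp only [Subalgebra.coe_add, Subalgebra.coe_sub, Subalgebra.coe_smul, Subalgebra.coe_mul,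
      Pi.add_apply, Pi.sub_apply, Pi.smul_apply, Pi.mul_apply, smul_eq_mul, e0, e1]
  · simp only [Subalgebra.coe_add, Subalgebra.coe_sub, Subalgebra.coe_smul, Subalgebra.coe_mul,
      Subalgebra.coe_one, Pi.add_apply, Pi.sub_apply, Pi.smul_apply, Pi.mul_apply, Pi.one_apply,
      smul_eq_mul, e0, e1, hS, hc, Function.uncurry]

/-- The shifted determinantal correlations depend only on the product of the two points. -/
theorem integral_shiftedCharpoly_mul (k : ℕ) (u v : ℝ) :
    finiteMoments.integral (shiftedGaussian k) ((shiftedCharpoly k).eval (algebraMap ℝ _ u) *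
      (shiftedCharpoly k).eval (algebraMap ℝ _ v)) = (detCorrelation k).eval (u * v) := by
  induction k generalizing u v with
  | zero =>
    rw [integral_charpoly_mul_charpoly_shifted_eq]
    simp [detCorrelation, Matrix.charpoly]
  | succ k ih =>
    have hne : ∀ u v, u ≠ v → finiteMoments.integral (shiftedGaussian (k + 1))
        ((shiftedCharpoly (k + 1)).eval (algebraMap ℝ _ u) *
          (shiftedCharpoly (k + 1)).eval (algebraMap ℝ _ v)) =
        (detCorrelation (k + 1)).eval (u * v) := fun u v huv => by
      refine mul_left_cancel₀ (sub_ne_zero.2 huv) ?_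
      rw [integral_shiftedCharpoly_succ]
      set p := shiftedCharpoly k
      set E := finiteMoments.integral (shiftedGaussian k)
      set f := detCorrelation k with hf
      have hd : ∀ (g : Polynomial ℝ) (u v : ℝ), HasDerivAt (fun u : ℝ => g.eval (u * v))
          (v * g.derivative.eval (u * v)) u := fun g u v => by
        refine ((g.hasDerivAt (u * v)).comp u ((hasDerivAt_id u).mul_const v)).congr_deriv ?_
        ring
      have h10 : ∀ u v : ℝ, E (p.derivative.eval (algebraMap ℝ _ u) * p.eval (algebraMap ℝ _ v)) =
          v * f.derivative.eval (u * v) := fun u v => by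
        have h := hasDerivAt_linearMap_eval_mul E p (p.eval (algebraMap ℝ _ v)) u
        simp_rw [ih] at h
        exact h.unique (hd f u v)
      have h01 : ∀ u v : ℝ, E (p.eval (algebraMap ℝ _ u) * p.derivative.eval (algebraMap ℝ _ v)) =
          u * f.derivative.eval (u * v) := fun u v => by
        rw [mul_comm, h10, mul_comm u v]
      have h11 : ∀ u v : ℝ,
          E (p.derivative.eval (algebraMap ℝ _ u) * p.derivative.eval (algebraMap ℝ _ v)) =
          f.derivative.eval (u * v) + u * v * f.derivative.derivative.eval (u * v) := fun u v => by
        have h := hasDerivAt_linearMap_eval_mul E p (p.derivative.eval (algebraMap ℝ _ v)) u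
        simp_rw [h01] at h
        refine h.unique (((hasDerivAt_id' u).fun_mul (hd f.derivative u v)).congr_deriv ?_)
        ring
      simp only [map_add, map_sub, map_smul, smul_eq_mul, ih, h10, h01, h11]
      rw [detCorrelation, ← hf]
      simp only [Polynomial.eval_add, Polynomial.eval_mul, Polynomial.eval_X, Polynomial.eval_C]
      ring
    have hcont : Continuous fun u : ℝ => finiteMoments.integral (shiftedGaussian (k + 1))
        ((shiftedCharpoly (k + 1)).eval (algebraMap ℝ _ u) *
          (shiftedCharpoly (k + 1)).eval (algebraMap ℝ _ v)) :=
      continuous_iff_continuousAt.2 fun u =>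
        (hasDerivAt_linearMap_eval_mul _ _ _ u).continuousAt
    have hcont' : Continuous fun u : ℝ => (detCorrelation (k + 1)).eval (u * v) := by fun_prop
    exact congrFun (hcont.ext_on (dense_compl_singleton v) hcont' fun u hu => hne u v hu) u

theorem det_sub_smul_one_sq {k : ℕ} (M : Matrix (Fin k) (Fin k) ℝ) (u : ℝ) :
    (M - u • (1 : Matrix (Fin k) (Fin k) ℝ)).det ^ 2 = M.charpoly.eval u * M.charpoly.eval u := by
  have hu : Matrix.scalar (Fin k) u = u • 1 := (Matrix.smul_one_eq_diagonal u).symm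
  rw [Matrix.eval_charpoly, hu, ← neg_sub, Matrix.det_neg, mul_pow, ← pow_mul, mul_comm _ 2,
    pow_mul, neg_one_sq, one_pow, one_mul, sq]

theorem SymMat.measurable_det_sub_sq {k : ℕ} (u : ℝ) :
    Measurable fun Q : SymMat k => (Q.1 - u • (1 : Matrix (Fin k) (Fin k) ℝ)).det ^ 2 := by
  refine Measurable.pow_const ?_ 2
  simp only [Matrix.det_apply]
  exact Finset.measurable_fun_sum _ fun σ _ => (Finset.measurable_fun_prod _ fun i _ =>
    (SymMat.measurable_apply (σ i) i).sub_const _).const_smul _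

theorem integral_det_sub_sq_GOE (k : ℕ) (u : ℝ) :
    ∫ Q : SymMat k, (Q.1 - u • (1 : Matrix (Fin k) (Fin k) ℝ)).det ^ 2 ∂(GOE k) =
      ∫ x, (SymMat.ofUpper x).1.charpoly.eval u * (SymMat.ofUpper x).1.charpoly.eval u
        ∂(upperGaussian k) := by
  rw [GOE_eq_map, integral_map (SymMat.measurable_ofUpper k).aemeasurable
    (SymMat.measurable_det_sub_sq u).aestronglyMeasurable]
  simp_rw [det_sub_smul_one_sq]

theorem theorem1p7 (k : ℕ) (hk : 0 < k) :
    (∀ u : ℝ, Integrable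
      (fun Q : SymMat k => (Q.1 - u • (1 : Matrix (Fin k) (Fin k) ℝ)).det ^ 2) (GOE k)) ∧
    Integrable (fun u : ℝ =>
      (∫ Q : SymMat k, (Q.1 - u • (1 : Matrix (Fin k) (Fin k) ℝ)).det ^ 2 ∂(GOE k)) *
        Real.exp (-u ^ 2)) ∧
    ∫ u : ℝ, (∫ Q : SymMat k, (Q.1 - u • (1 : Matrix (Fin k) (Fin k) ℝ)).det ^ 2 ∂(GOE k)) *
        Real.exp (-u ^ 2) =
      √Real.pi * ((k + 2).factorial : ℝ) / 2 ^ (k + 1) := by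
  have hv : (1 / 2 : ℝ≥0) ≠ 0 := by simp
  have hπ : √Real.pi ≠ 0 := (Real.sqrt_pos.2 Real.pi_pos).ne'
  have hpdf : ∀ s, Real.exp (-s ^ 2) = √Real.pi * gaussianPDFReal 0 (1 / 2) s := fun s => by
    have h1 : 2 * Real.pi * ((1 / 2 : ℝ≥0) : ℝ) = Real.pi := by push_cast; ring
    have h2 : 2 * ((1 / 2 : ℝ≥0) : ℝ) = 1 := by push_cast; ring
    rw [gaussianPDFReal, h1, h2, mul_inv_cancel_left₀ hπ, sub_zero, div_one]
  simp_rw [integral_det_sub_sq_GOE, hpdf]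
  refine ⟨fun u => ?_, ?_, ?_⟩
  · rw [GOE_eq_map, integrable_map_measure
      (SymMat.measurable_det_sub_sq u).aestronglyMeasurable
      (SymMat.measurable_ofUpper k).aemeasurable]
    simp only [Function.comp_def, det_sub_smul_one_sq]
    exact finiteMoments.integrable ⟨_, mul_mem (charpoly_mem_finiteMoments_upperGaussian k u)
      (charpoly_mem_finiteMoments_upperGaussian k u)⟩
  · have h := (integrable_charpoly_mul_charpoly_shifted k 0 0).integral_prod_left
    simp only [zero_add] at h
    rw [gaussianReal_of_var_ne_zero _ hv, integrable_withDensity_iff_integrable_smul'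
      (measurable_gaussianPDF _ _) (.of_forall fun _ => gaussianPDF_lt_top)] at h
    refine (h.const_mul (√Real.pi)).congr (.of_forall fun s => ?_)
    simp only [toReal_gaussianPDF, smul_eq_mul]
    ring
  · have h := integral_shiftedCharpoly_mul k 0 0
    rw [integral_charpoly_mul_charpoly_shifted_eq, mul_zero, detCorrelation_eval_zero,
      integral_gaussianReal_eq_integral_smul hv] at h
    simp only [zero_add, smul_eq_mul] at h
    rw [mul_div_assoc, ← h, ← integral_const_mul]
    refine integral_congr_ae (.of_forall fun s => ?_)
    simp only
    ring
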